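/- A two-way $k$-head nondeterministic finite automaton (2nfa($k$)) is a tuple $M=(Q,\Sigma,\delta,q_0,q_{\mathrm{acc}},q_{\mathrm{rej}})$ with a finite state set $Q$, a finite input alphabet $\Sigma$, states $q_0,q_{\mathrm{acc}},q_{\mathrm{rej}}\in Q$, and a transition function $\delta\colon Q\times\Gamma^k\to\mathcal P(Q\times\Delta^k)$, where $\Gamma=\Sigma\sqcup\{\rhd,\lhd\}$ and $\Delta=\{\text{left},\text{stay},\text{right}\}$. On input $x\in\Sigma^*$ it starts in state $q_0$ with all $k$ heads on the symbol $\rhd$ of the read-only tape $\rhd x\lhd$; in each step it picks some $(r,d)\in\delta(q,y)$, where $q$ is its state and $y\in\Gamma^k$ are the symbols under its heads, goes to state $r$ and moves its $i$-th head by $d_i$ (a head told to move past an end marker stays on it). A computational path halts if it reaches $q_{\mathrm{acc}}$ or $q_{\mathrm{rej}}$, or if $\delta$ offers no further step. $M$ is always halting if on every input every computational path halts. A 2nfa is a 2nfa($1$). For $1\le i\le k$ let $M_i$ be the 2nfa with the same states, alphabet, and initial, accept and reject states as $M$ and with the transition function $$\delta_i(q,x)=\bigcup_{y\in\Gamma^k,\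 y_i=x}\{(r,d_i)\mid (r,d)\in\delta(q,y)\}.$$ The $i$-th head of $M$ is safe if $M_i$ is always halting, and risky otherwise. Let $\langle M\rangle$ denote an encoding of $M$ that, with states and input symbols numbered, gives the numbers of heads, states and input symbols, the states $q_0,q_{\mathrm{acc}},q_{\mathrm{rej}}$, and a list of the transitions. Then: 1. The set $\{\langle M\rangle\mid M\text{ is an always halting 2nfa}\}$ is decidable. 2. The sets $\{(\langle M\rangle,i)\mid k\ge 1,\ M\text{ is a 2nfa}(k),\ 1\le i\le k,\ \text{the }i\text{-th head of }M\text{ is safe}\}$ and $\{(\langle M\rangle,i)\mid k\ge 1,\ M\text{ is a 2nfa}(k),\ 1\le i\le k,\ \text{the }i\text{-th head of }M\text{ is risky}\}$ are decidable. -/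

import Mathlib

/-- Tape symbols: the input symbols together with the left and right end markers. -/
inductive TapeSym (S : Type) : Type
  | leftEnd : TapeSym S
  | rightEnd : TapeSym S
  | sym (a : S) : TapeSym S

/-- Head movements: left, stay put, right. -/
inductive HeadMove : Type
  | left : HeadMove
  | stay : HeadMove
  | right : HeadMove

/-- A two-way `k`-head nondeterministic finite automaton with state set `Q` and input alphabet `S`
(both are finite wherever such automata are encoded below). -/
structure MultiheadNFA (k : ℕ) (Q S : Type) where
  /-- the transition function -/
  delta : Q → (Fin k → TapeSym S) → Set (Q × (Fin k → HeadMove))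
  /-- the initial state -/
  q0 : Q
  /-- the accept state -/
  qacc : Q
  /-- the reject state -/
  qrej : Q

/-- The symbol in cell `p` of the tape holding the left end marker (cell `0`), the input `x`
(cells `1, …, |x|`), and the right end marker (cell `|x| + 1`). -/
def readTape {S : Type} (x : List S) (p : Fin (x.length + 2)) : TapeSym S :=
  if p.val = 0 then TapeSym.leftEnd
  else match x[p.val - 1]? with
    | some a => TapeSym.sym a
    | none => TapeSym.rightEnd

/-- The new position of a head on a tape of `N + 2` cells.  A head that is told to move past an
end marker stays on the end marker. -/
def moveHead {N : ℕ} (p : Fin (N + 2)) : HeadMove → Fin (N + 2)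
  | HeadMove.left => ⟨p.val - 1, by omega⟩
  | HeadMove.stay => p
  | HeadMove.right => ⟨min (p.val + 1) (N + 1), by omega⟩

namespace MultiheadNFA

/-- Configurations on the input `x`: the state and the positions of the `k` heads. -/
abbrev Config {S : Type} (k : ℕ) (Q : Type) (x : List S) : Type :=
  Q × (Fin k → Fin (x.length + 2))

variable {k : ℕ} {Q S : Type}

/-- The initial configuration: initial state, all heads on the left end marker. -/
def initConfig (M : MultiheadNFA k Q S) (x : List S) : Config k Q x :=
  (M.q0, fun _ => 0)

/-- The alternatives that the transition function offers in a configuration. -/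
def options (M : MultiheadNFA k Q S) {x : List S} (c : Config k Q x) :
    Set (Q × (Fin k → HeadMove)) :=
  M.delta c.1 (fun j => readTape x (c.2 j))

/-- `c'` results from `c` by picking one of the offered alternatives. -/
def Step (M : MultiheadNFA k Q S) {x : List S} (c c' : Config k Q x) : Prop :=
  ∃ e ∈ M.options c, c' = (e.1, fun j => moveHead (c.2 j) (e.2 j))

/-- The computation halts in `c`: accept state, reject state, or no further alternative. -/
def Halted (M : MultiheadNFA k Q S) {x : List S} (c : Config k Q x) : Prop :=
  c.1 = M.qacc ∨ c.1 = M.qrej ∨ M.options c = ∅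

/-- A computational path on `x`, as an infinite sequence: it starts in the initial configuration,
makes a step as long as it has not halted, and is constant from the moment it halts. -/
def IsPath (M : MultiheadNFA k Q S) (x : List S) (p : ℕ → Config k Q x) : Prop :=
  p 0 = M.initConfig x ∧
    ∀ t, (¬ M.Halted (p t) → M.Step (p t) (p (t + 1))) ∧ (M.Halted (p t) → p (t + 1) = p t)

/-- On every input string, every computational path halts. -/
def AlwaysHalting (M : MultiheadNFA k Q S) : Prop :=
  ∀ (x : List S) (p : ℕ → Config k Q x), M.IsPath x p → ∃ t, M.Halted (p t)

/-- The one-head automaton `M_i` of the `i`-th head of `M`: on reading `z` it may make the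
`i`-th part of any transition of `M` in which the `i`-th head reads `z`. -/
def headNFA (M : MultiheadNFA k Q S) (i : Fin k) : MultiheadNFA 1 Q S where
  delta q z := {e | ∃ y : Fin k → TapeSym S, y i = z 0 ∧
    ∃ r d, (r, d) ∈ M.delta q y ∧ e = (r, fun _ => d i)}
  q0 := M.q0
  qacc := M.qacc
  qrej := M.qrej

/-- The `i`-th head of `M` is safe. -/
def SafeHead (M : MultiheadNFA k Q S) (i : Fin k) : Prop :=
  (M.headNFA i).AlwaysHalting

/-- The `i`-th head of `M` is risky. -/
def RiskyHead (M : MultiheadNFA k Q S) (i : Fin k) : Prop :=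
  ¬ (M.headNFA i).AlwaysHalting

end MultiheadNFA

/-- A written transition: state, symbols read, new state, head movements. -/
abbrev TransitionCode : Type := ℕ × List ℕ × ℕ × List ℕ

/-- A written automaton: number of heads, number of states, number of input symbols, initial
state, accept state, reject state, and a list of transitions. -/
abbrev AutomatonCode : Type := ℕ × ℕ × ℕ × ℕ × ℕ × ℕ × List TransitionCode

/-- The number of a tape symbol. -/
def TapeSym.code {m : ℕ} : TapeSym (Fin m) → ℕ
  | TapeSym.leftEnd => 0
  | TapeSym.rightEnd => 1
  | TapeSym.sym a => a.val + 2

/-- The number of a head movement. -/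
def HeadMove.code : HeadMove → ℕ
  | HeadMove.left => 0
  | HeadMove.stay => 1
  | HeadMove.right => 2

/-- The written form of the transition `(r, d) ∈ δ(q, y)`. -/
def transitionCode {k n m : ℕ} (q : Fin n) (y : Fin k → TapeSym (Fin m)) (r : Fin n)
    (d : Fin k → HeadMove) : TransitionCode :=
  (q.val, List.ofFn (fun j => (y j).code), r.val, List.ofFn (fun j => (d j).code))

/-- `c` is an encoding of `M`, an automaton with states `0, …, n - 1` and input symbols
`0, …, m - 1`: it states all the parameters of `M` and a list, in any order, of exactly the
transitions of `M`. -/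
def Encodes {k n m : ℕ} (c : AutomatonCode) (M : MultiheadNFA k (Fin n) (Fin m)) : Prop :=
  ∃ L : List TransitionCode,
    c = (k, n, m, M.q0.val, M.qacc.val, M.qrej.val, L) ∧
    ∀ e, e ∈ L ↔ ∃ q y r d, (r, d) ∈ M.delta q y ∧ e = transitionCode q y r d

theorem TapeSym.code_injective {m : ℕ} : Function.Injective (TapeSym.code (m := m)) := by
  intro a b h
  cases a <;> cases b <;> simp_all [TapeSym.code, Fin.ext_iff]

theorem HeadMove.code_injective : Function.Injective HeadMove.code := by
  intro a b h
  cases a <;> cases b <;> simp_all [HeadMove.code]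

instance : Finite HeadMove :=
  Finite.of_injective (fun a : HeadMove => (⟨a.code, by cases a <;> simp [HeadMove.code]⟩ : Fin 3))
    (fun _ _ h => HeadMove.code_injective (Fin.ext_iff.mp h))

instance {m : ℕ} : Finite (TapeSym (Fin m)) :=
  Finite.of_injective
    (fun a : TapeSym (Fin m) =>
      (⟨a.code, by cases a <;> simp [TapeSym.code]⟩ : Fin (m + 2)))
    (fun _ _ h => TapeSym.code_injective (Fin.ext_iff.mp h))

/-- Every automaton has an encoding. -/
theorem exists_encodes {k n m : ℕ} (M : MultiheadNFA k (Fin n) (Fin m)) :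
    ∃ c, Encodes c M := by
  classical
  let f : Fin n × (Fin k → TapeSym (Fin m)) × Fin n × (Fin k → HeadMove) → TransitionCode :=
    fun t => transitionCode t.1 t.2.1 t.2.2.1 t.2.2.2
  have hfin : (f '' {t | (t.2.2.1, t.2.2.2) ∈ M.delta t.1 t.2.1}).Finite := Set.toFinite _
  refine ⟨_, hfin.toFinset.toList, rfl, fun e => ?_⟩
  simp only [Finset.mem_toList, Set.Finite.mem_toFinset, Set.mem_image, Set.mem_ofPred_eq]
  constructor
  · rintro ⟨⟨q, y, r, d⟩, h, rfl⟩
    exact ⟨q, y, r, d, h, rfl⟩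
  · rintro ⟨q, y, r, d, h, rfl⟩
    exact ⟨⟨q, y, r, d⟩, h, rfl⟩

/-- An encoding determines the automaton. -/
theorem encodes_unique {k n m : ℕ} {c : AutomatonCode} {M M' : MultiheadNFA k (Fin n) (Fin m)}
    (h : Encodes c M) (h' : Encodes c M') : M = M' := by
  obtain ⟨L, rfl, hL⟩ := h
  obtain ⟨L', e, hL'⟩ := h'
  simp only [Prod.mk.injEq, true_and] at e
  obtain ⟨h0, h1, h2, rfl⟩ := e
  have key : ∀ (A B : MultiheadNFA k (Fin n) (Fin m)),
      (∀ e, e ∈ L ↔ ∃ q y r d, (r, d) ∈ A.delta q y ∧ e = transitionCode q y r d) →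
      (∀ e, e ∈ L ↔ ∃ q y r d, (r, d) ∈ B.delta q y ∧ e = transitionCode q y r d) →
      ∀ q y r d, (r, d) ∈ A.delta q y → (r, d) ∈ B.delta q y := by
    intro A B hA hB q y r d h
    obtain ⟨q', y', r', d', h', e⟩ := (hB _).1 ((hA _).2 ⟨q, y, r, d, h, rfl⟩)
    simp only [transitionCode, Prod.mk.injEq, List.ofFn_inj] at e
    obtain ⟨e1, e2, e3, e4⟩ := e
    have e1 := Fin.ext e1
    have e3 := Fin.ext e3
    have e2 : y = y' := funext fun j => TapeSym.code_injective (congrFun e2 j)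
    have e4 : d = d' := funext fun j => HeadMove.code_injective (congrFun e4 j)
    subst e1 e2 e3 e4
    exact h'
  have hd : M.delta = M'.delta := by
    funext q y
    ext ⟨r, d⟩
    exact ⟨key M M' hL hL' q y r d, key M' M hL' hL q y r d⟩
  cases M
  cases M'
  simp only [MultiheadNFA.mk.injEq]
  exact ⟨hd, Fin.ext h0, Fin.ext h1, Fin.ext h2⟩

/-- The set of encodings of always halting one-head automata. -/
def Decider2NFA : Set AutomatonCode :=
  {c | ∃ (n m : ℕ) (M : MultiheadNFA 1 (Fin n) (Fin m)), Encodes c M ∧ M.AlwaysHalting}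

/-- The set of pairs (encoding of a multi-head automaton, index of a safe head of it), where
heads are numbered from `0`. -/
def SafeHeads : Set (AutomatonCode × ℕ) :=
  {p | ∃ (k n m : ℕ) (M : MultiheadNFA k (Fin n) (Fin m)) (i : Fin k),
    Encodes p.1 M ∧ p.2 = i.val ∧ M.SafeHead i}

/-- The set of pairs (encoding of a multi-head automaton, index of a risky head of it), where
heads are numbered from `0`. -/
def RiskyHeads : Set (AutomatonCode × ℕ) :=
  {p | ∃ (k n m : ℕ) (M : MultiheadNFA k (Fin n) (Fin m)) (i : Fin k),
    Encodes p.1 M ∧ p.2 = i.val ∧ M.RiskyHead i}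

/-!
In the computation of a one-head automaton with `n` states, a prefix of the tape counts only through
its behaviour: for each way of entering it, whether the head can stay inside forever, and in which
states it can leave. There are only `(2 * 2 ^ n) ^ (n + 1)` behaviours. If two prefixes of an input
have the same behaviour, then cutting out the part between them does not destroy an infinite
computation, so a shortest input with an infinite computation is shorter than this bound. On a given
input, an infinite computation exists as soon as there is one with more steps than configurations.
It therefore suffices to try finitely many inputs for a bounded number of steps, and the automaton
of the `i`-th head can be run directly on the encoding of the multi-head automaton.
-/

section Relations

variable {α β : Type*} {r : α → α → Prop} {a b : α}

/-- There is no infinite sequence of `r`-steps from `a`. -/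
abbrev TerminatesFrom (r : α → α → Prop) (a : α) : Prop :=
  Acc (Function.swap r) a

/-- There is a sequence of `t` consecutive `r`-steps from `a`. -/
def HasRun (r : α → α → Prop) : ℕ → α → Prop
  | 0, _ => True
  | t + 1, a => ∃ b, r a b ∧ HasRun r t b

theorem terminatesFrom_transGen_iff :
    TerminatesFrom (Relation.TransGen r) a ↔ TerminatesFrom r a :=
  ⟨Subrelation.accessible (fun h => .single h),
    fun ha => Subrelation.accessible Relation.transGen_swap.2 (Acc.transGen ha)⟩

theorem TerminatesFrom.not_rel_self (ha : TerminatesFrom r a) : ¬ r a a := by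
  induction ha with
  | intro a _ ih => exact fun haa => ih a haa haa

theorem HasRun.lt_ncard_of_terminatesFrom [Finite α] {t : ℕ} (hrun : HasRun r t a)
    (ha : TerminatesFrom r a) : t < {b | Relation.ReflTransGen r a b}.ncard := by
  induction t generalizing a with
  | zero => exact (Set.ncard_pos).2 ⟨a, .refl⟩
  | succ t ih =>
    obtain ⟨b, hab, hrun⟩ := hrun
    have hba : ¬ Relation.ReflTransGen r b a := fun hba =>
      (terminatesFrom_transGen_iff.2 ha).not_rel_self (.head' hab hba)
    have hssub : {c | Relation.ReflTransGen r b c} ⊂ {c | Relation.ReflTransGen r a c} :=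
      Set.ssubset_iff_of_subset (fun _ hbc => .head hab hbc) |>.2 ⟨a, .refl, hba⟩
    exact (Nat.succ_le_of_lt (ih hrun (ha.inv hab))).trans_lt (Set.ncard_lt_ncard hssub)

theorem hasRun_of_not_terminatesFrom (ha : ¬ TerminatesFrom r a) (t : ℕ) : HasRun r t a := by
  induction t generalizing a with
  | zero => trivial
  | succ t ih =>
    obtain ⟨b, hb, hab⟩ := exists_not_acc_lt_of_not_acc ha
    exact ⟨b, hab, ih hb⟩

theorem terminatesFrom_iff_not_hasRun [Finite α] {t : ℕ} (ht : Nat.card α ≤ t) :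
    TerminatesFrom r a ↔ ¬ HasRun r t a := by
  refine ⟨fun ha hrun => ?_, fun hrun => by_contra fun ha =>
    hrun (hasRun_of_not_terminatesFrom ha t)⟩
  exact ((hrun.lt_ncard_of_terminatesFrom ha).trans_le (Set.ncard_le_card _)).not_ge ht

/-- `f` maps the `r`-steps from `a` onto the `s`-steps from `f a`. -/
def IsBisimulationMap (r : α → α → Prop) (s : β → β → Prop) (f : α → β) : Prop :=
  ∀ a b, s (f a) b ↔ ∃ a', r a a' ∧ f a' = b

variable {s : β → β → Prop} {f : α → β}

theorem IsBisimulationMap.terminatesFrom_iff (h : IsBisimulationMap r s f) :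
    TerminatesFrom s (f a) ↔ TerminatesFrom r a := by
  refine ⟨fun ha => ?_, Acc.of_fibration f fun a b => (h a b).1⟩
  exact Subrelation.accessible (fun {_ b} hab => (h b _).2 ⟨_, hab, rfl⟩) (InvImage.accessible f ha)

theorem IsBisimulationMap.hasRun_iff (h : IsBisimulationMap r s f) {t : ℕ} :
    HasRun s t (f a) ↔ HasRun r t a := by
  induction t generalizing a with
  | zero => rfl
  | succ t ih => simp only [HasRun, h a, ← ih]; grind

/-- An `r`-step that starts and ends in `S`. -/
def StepWithin (r : α → α → Prop) (S : Set α) (a b : α) : Prop :=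
  r a b ∧ a ∈ S ∧ b ∈ S

/-- A sequence of `r`-steps leads from `a` through elements of `S` and then, in its last step, to
the element `b` outside `S`. -/
def ExitsTo (r : α → α → Prop) (S : Set α) (a b : α) : Prop :=
  b ∉ S ∧ ∃ a' ∈ S, Relation.ReflTransGen (StepWithin r S) a a' ∧ r a' b

variable {S : Set α}

theorem ExitsTo.head (hab : StepWithin r S a b) {c : α} (hbc : ExitsTo r S b c) :
    ExitsTo r S a c := by
  obtain ⟨hc, b', hb', hbb', hstep⟩ := hbc
  exact ⟨hc, b', hb', .head hab hbb', hstep⟩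

theorem ExitsTo.transGen (hab : ExitsTo r S a b) : Relation.TransGen r a b := by
  obtain ⟨-, a', -, haa', hstep⟩ := hab
  exact .tail' (Relation.ReflTransGen.mono (fun _ _ h => h.1) _ _ haa') hstep

theorem TerminatesFrom.stepWithin (ha : TerminatesFrom r a) :
    TerminatesFrom (StepWithin r S) a :=
  Subrelation.accessible (fun h => h.1) ha

theorem TerminatesFrom.of_stepWithin (ha : TerminatesFrom (StepWithin r S) a) (haS : a ∈ S)
    (hexit : ∀ b, ExitsTo r S a b → TerminatesFrom r b) : TerminatesFrom r a := by
  induction ha with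
  | intro a _ ih =>
    refine ⟨_, fun b (hab : r a b) => ?_⟩
    by_cases hbS : b ∈ S
    · have hab' : StepWithin r S a b := ⟨hab, haS, hbS⟩
      exact ih b hab' hbS fun c hbc => hexit c (hbc.head hab')
    · exact hexit b ⟨hbS, a, haS, .refl, hab⟩

end Relations

/-- The new position of a head that moves from cell `p`, where it reads `z`, on a tape without a
last cell: only the symbol `z` tells whether the head is on the right end marker. -/
def TapeSym.shift {S : Type} : TapeSym S → HeadMove → ℕ → ℕ
  | _, .left, p => p - 1
  | _, .stay, p => p
  | rightEnd, .right, p => p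
  | _, .right, p => p + 1

theorem TapeSym.shift_le_succ {S : Type} (z : TapeSym S) (d : HeadMove) (p : ℕ) :
    z.shift d p ≤ p + 1 := by
  cases z <;> cases d <;> simp only [shift] <;> omega

theorem TapeSym.exists_shift_eq_add {S : Type} (z : TapeSym S) (d : HeadMove) (s : ℕ) :
    ∃ t, ∀ i, z.shift d (i + 1 + s) = i + t := by
  cases z <;> cases d
  all_goals first
    | exact ⟨s, fun i => by simp only [shift]; omega⟩
    | exact ⟨s + 1, fun i => by simp only [shift]; omega⟩
    | exact ⟨s + 2, fun i => by simp only [shift]; omega⟩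

/-- The tape of the input `x`, continued to the right by right end markers. -/
def inputTape {S : Type} (x : List S) (p : ℕ) : TapeSym S :=
  (.leftEnd :: x.map .sym).getD p .rightEnd

theorem readTape_eq_inputTape {S : Type} (x : List S) (p : Fin (x.length + 2)) :
    readTape x p = inputTape x p := by
  obtain ⟨_ | p, hp⟩ := p
  · rfl
  · cases h : x[p]? <;> simp [readTape, inputTape, h]

theorem inputTape_succ {S : Type} (x : List S) (p : ℕ) :
    inputTape x (p + 1) = (x[p]?.map .sym).getD .rightEnd := by
  rw [inputTape, List.getD_cons_succ, List.getD_eq_getElem?_getD, List.getElem?_map]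

theorem inputTape_take_append_of_le {S : Type} {x y : List S} {i p : ℕ} (hi : i ≤ x.length)
    (hp : p ≤ i) : inputTape (x.take i ++ y) p = inputTape x p := by
  obtain _ | p := p
  · rfl
  · have hlt : p < (x.take i).length := by rw [List.length_take_of_le hi]; exact hp
    rw [inputTape_succ, inputTape_succ, List.getElem?_append_left hlt, List.getElem?_take_of_lt hp]

theorem inputTape_append_drop {S : Type} (u x : List S) (j s : ℕ) :
    inputTape (u ++ x.drop j) (u.length + 1 + s) = inputTape x (j + 1 + s) := by
  rw [Nat.add_right_comm, Nat.add_right_comm j, inputTape_succ, inputTape_succ,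
    List.getElem?_append_right (Nat.le_add_right _ _), List.getElem?_drop, Nat.add_sub_cancel_left]

theorem val_moveHead {S : Type} {x : List S} (p : Fin (x.length + 2)) (d : HeadMove) :
    (moveHead p d).val = (inputTape x p).shift d p := by
  rw [← readTape_eq_inputTape]
  cases d with
  | left => rfl
  | stay => rfl
  | right =>
    obtain ⟨_ | p, hp⟩ := p
    · simp [moveHead, readTape, TapeSym.shift]
    · obtain hend | hlt : p = x.length ∨ p < x.length := by omega
      · simp [moveHead, readTape, TapeSym.shift, hend]
      · simp [moveHead, readTape, TapeSym.shift, hlt]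

namespace MultiheadNFA

/-- A step from a configuration that is not halted. -/
def LiveStep {k : ℕ} {Q S : Type} (M : MultiheadNFA k Q S) {x : List S} (c c' : Config k Q x) :
    Prop :=
  ¬ M.Halted c ∧ M.Step c c'

theorem alwaysHalting_iff_terminatesFrom {k : ℕ} {Q S : Type} (M : MultiheadNFA k Q S) :
    M.AlwaysHalting ↔ ∀ x, TerminatesFrom M.LiveStep (M.initConfig x) := by
  refine forall_congr' fun x => not_iff_not.1 ?_
  rw [not_acc_iff_exists_descending_chain]
  push Not
  refine exists_congr fun p => ⟨?_, ?_⟩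
  · rintro ⟨⟨h0, hp⟩, hlive⟩
    exact ⟨h0, fun t => ⟨hlive t, (hp t).1 (hlive t)⟩⟩
  · rintro ⟨h0, hp⟩
    exact ⟨⟨h0, fun t => ⟨fun _ => (hp t).2, fun h => absurd h (hp t).1⟩⟩, fun t => (hp t).1⟩

variable {Q S : Type} {M : MultiheadNFA 1 Q S}

/-- A transition of a one-head automaton from a state that is neither accepting nor rejecting. -/
def LiveTransition (M : MultiheadNFA 1 Q S) (q : Q) (z : TapeSym S) (r : Q) (d : HeadMove) :
    Prop :=
  q ≠ M.qacc ∧ q ≠ M.qrej ∧ (r, fun _ => d) ∈ M.delta q fun _ => z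

theorem liveStep_iff {x : List S} {c c' : Config 1 Q x} :
    M.LiveStep c c' ↔ ∃ d, M.LiveTransition c.1 (readTape x (c.2 0)) c'.1 d ∧
      c'.2 0 = moveHead (c.2 0) d := by
  have hread : (fun i => readTape x (c.2 i)) = fun _ => readTape x (c.2 0) :=
    funext fun i => by rw [Subsingleton.elim i 0]
  simp only [LiveStep, Halted, Step, options, LiveTransition, hread, not_or]
  constructor
  · rintro ⟨⟨hacc, hrej, -⟩, ⟨r, d⟩, hmem, rfl⟩
    have hd : d = fun _ => d 0 := funext fun i => by rw [Subsingleton.elim i 0]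
    exact ⟨d 0, ⟨hacc, hrej, hd ▸ hmem⟩, rfl⟩
  · rintro ⟨d, ⟨hacc, hrej, hmem⟩, hpos⟩
    refine ⟨⟨hacc, hrej, Set.nonempty_iff_ne_empty.1 ⟨_, hmem⟩⟩, _, hmem, Prod.ext rfl ?_⟩
    funext i
    rw [Subsingleton.elim i 0, hpos]

/-- A step of a one-head automaton between pairs of a state and a head position, on an arbitrary
infinite tape. -/
def TapeStep (M : MultiheadNFA 1 Q S) (w : ℕ → TapeSym S) (c c' : Q × ℕ) : Prop :=
  ∃ d, M.LiveTransition c.1 (w c.2) c'.1 d ∧ c'.2 = (w c.2).shift d c.2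

theorem isBisimulationMap_tapeStep (x : List S) :
    IsBisimulationMap (M.LiveStep (x := x)) (M.TapeStep (inputTape x))
      fun c => (c.1, (c.2 0).val) := by
  rintro ⟨q, p⟩ ⟨r, p'⟩
  constructor
  · rintro ⟨d, hlive, hpos⟩
    refine ⟨(r, fun _ => moveHead (p 0) d), liveStep_iff.2 ⟨d, ?_, rfl⟩, ?_⟩
    · rwa [readTape_eq_inputTape]
    · exact Prod.ext rfl ((val_moveHead _ _).trans hpos.symm)
  · rintro ⟨c, hstep, hc⟩
    obtain ⟨rfl, rfl⟩ := Prod.mk.inj hc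
    obtain ⟨d, hlive, hpos⟩ := liveStep_iff.1 hstep
    exact ⟨d, readTape_eq_inputTape x (p 0) ▸ hlive, by rw [hpos, val_moveHead]⟩

variable {w w' : ℕ → TapeSym S} {i j : ℕ}

theorem TapeStep.snd_le_succ {c c' : Q × ℕ} (h : M.TapeStep w c c') : c'.2 ≤ c.2 + 1 := by
  obtain ⟨d, -, hpos⟩ := h
  exact hpos.trans_le (TapeSym.shift_le_succ _ _ _)

/-- The configurations in which the head is in one of the cells `0, …, j`. -/
abbrev prefixConfigs (Q : Type) (j : ℕ) : Set (Q × ℕ) :=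
  {c | c.2 ≤ j}

theorem exitsTo_prefixConfigs_snd {c b : Q × ℕ}
    (h : ExitsTo (M.TapeStep w) (prefixConfigs Q j) c b) : b.2 = j + 1 := by
  obtain ⟨hb, a, ha, -, hab⟩ := h
  have hle := hab.snd_le_succ
  simp only [Set.mem_ofPred_eq] at hb ha
  omega

/-- Where a one-head automaton may begin a computation within the cells `0, …, j`: at its initial
configuration (`none`), or by entering cell `j` from the right in a given state. -/
def prefixEntry (M : MultiheadNFA 1 Q S) (j : ℕ) : Option Q → Q × ℕ
  | none => (M.q0, 0)
  | some q => (q, j)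

theorem prefixEntry_mem (e : Option Q) : M.prefixEntry j e ∈ prefixConfigs Q j := by
  cases e <;> simp [prefixEntry]

/-- What the rest of the tape can observe of the cells `0, …, j`: for each way of entering them,
whether every computation within them ends, and in which states the head can leave them. -/
def prefixBehaviour (M : MultiheadNFA 1 Q S) (w : ℕ → TapeSym S) (j : ℕ) :
    Option Q → Prop × Set Q := fun e =>
  (TerminatesFrom (StepWithin (M.TapeStep w) (prefixConfigs Q j)) (M.prefixEntry j e),
    {r | ExitsTo (M.TapeStep w) (prefixConfigs Q j) (M.prefixEntry j e) (r, j + 1)})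

theorem prefixBehaviour_congr (h : ∀ p ≤ i, w p = w' p) :
    M.prefixBehaviour w i = M.prefixBehaviour w' i := by
  have hstep : ∀ c ∈ prefixConfigs Q i, ∀ b, M.TapeStep w c b ↔ M.TapeStep w' c b :=
    fun c hc b => by simp only [TapeStep, h c.2 hc]
  have hwithin : StepWithin (M.TapeStep w) (prefixConfigs Q i) =
      StepWithin (M.TapeStep w') (prefixConfigs Q i) := by
    ext a b
    simp only [StepWithin]
    grind
  ext e r
  · simp only [prefixBehaviour, hwithin]
  · simp only [prefixBehaviour, ExitsTo, hwithin, Set.mem_ofPred_eq]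
    grind

theorem terminatesFrom_prefixEntry (hb : M.prefixBehaviour w' i = M.prefixBehaviour w j)
    {e : Option Q} (he : TerminatesFrom (M.TapeStep w') (M.prefixEntry i e))
    (hexit : ∀ r, ExitsTo (M.TapeStep w') (prefixConfigs Q i) (M.prefixEntry i e) (r, i + 1) →
      TerminatesFrom (M.TapeStep w) (r, j + 1)) :
    TerminatesFrom (M.TapeStep w) (M.prefixEntry j e) := by
  obtain ⟨hterm, hexits⟩ := Prod.ext_iff.1 (congrFun hb e)
  refine TerminatesFrom.of_stepWithin (hterm.mp he.stepWithin) (prefixEntry_mem e) ?_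
  rintro ⟨r, p⟩ hr
  obtain rfl : p = j + 1 := exitsTo_prefixConfigs_snd hr
  exact hexit r (hexits.symm.subset hr)

theorem terminatesFrom_suffix (hb : M.prefixBehaviour w' i = M.prefixBehaviour w j)
    (hsuffix : ∀ s, w' (i + 1 + s) = w (j + 1 + s)) {q : Q} {s : ℕ}
    (h : TerminatesFrom (M.TapeStep w') (q, i + 1 + s)) :
    TerminatesFrom (M.TapeStep w) (q, j + 1 + s) := by
  generalize hc : (q, i + 1 + s) = c at h
  -- With `TransGen`, the induction hypothesis also applies after a whole excursion into the prefix.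
  rw [← terminatesFrom_transGen_iff] at h
  induction h generalizing q s with
  | intro c hacc ih =>
    subst hc
    refine ⟨_, fun c' (hstep : M.TapeStep w _ c') => ?_⟩
    obtain ⟨r, p⟩ := c'
    obtain ⟨d, hlive, hpos⟩ := hstep
    obtain ⟨t, ht⟩ := (w (j + 1 + s)).exists_shift_eq_add d s
    obtain rfl : p = j + t := hpos.trans (ht j)
    have hstep' : M.TapeStep w' (q, i + 1 + s) (r, i + t) :=
      ⟨d, (hsuffix s).symm ▸ hlive, by simp only [hsuffix, ht]⟩
    obtain rfl | ⟨t, rfl⟩ : t = 0 ∨ ∃ s', t = 1 + s' :=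
      t.eq_zero_or_pos.imp_right Nat.exists_eq_add_of_le
    · refine terminatesFrom_prefixEntry (e := some r) hb
        (terminatesFrom_transGen_iff.1 (hacc _ (.single hstep'))) fun q' hexit => ?_
      exact ih _ (.head hstep' hexit.transGen) (s := 0) rfl
    · rw [← Nat.add_assoc] at hstep' ⊢
      exact ih _ (.single hstep') rfl

theorem terminatesFrom_of_prefixBehaviour_eq
    (hb : M.prefixBehaviour w' i = M.prefixBehaviour w j)
    (hsuffix : ∀ s, w' (i + 1 + s) = w (j + 1 + s))
    (h : TerminatesFrom (M.TapeStep w') (M.q0, 0)) :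
    TerminatesFrom (M.TapeStep w) (M.q0, 0) :=
  terminatesFrom_prefixEntry (e := none) hb h fun _ hr =>
    terminatesFrom_suffix (s := 0) hb hsuffix <| terminatesFrom_transGen_iff.1 <|
      (terminatesFrom_transGen_iff.2 h).inv hr.transGen

theorem terminatesFrom_initConfig_iff {x : List S} :
    TerminatesFrom M.LiveStep (M.initConfig x) ↔
      TerminatesFrom (M.TapeStep (inputTape x)) (M.q0, 0) :=
  (isBisimulationMap_tapeStep x).terminatesFrom_iff.symm

theorem terminatesFrom_of_cut {x : List S} (hi : i ≤ x.length)
    (hb : M.prefixBehaviour (inputTape x) i = M.prefixBehaviour (inputTape x) j)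
    (hcut : TerminatesFrom M.LiveStep (M.initConfig (x.take i ++ x.drop j))) :
    TerminatesFrom M.LiveStep (M.initConfig x) := by
  rw [terminatesFrom_initConfig_iff] at hcut ⊢
  refine terminatesFrom_of_prefixBehaviour_eq (i := i) (j := j) (.trans ?_ hb) (fun s => ?_) hcut
  · exact prefixBehaviour_congr fun p hp => inputTape_take_append_of_le hi hp
  · simpa only [List.length_take_of_le hi] using inputTape_append_drop (x.take i) x j s

/-- The number of possible values of `prefixBehaviour` for an automaton with `n` states. -/
def behaviourCount (n : ℕ) : ℕ :=
  (2 * 2 ^ n) ^ (n + 1)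

theorem card_prefixBehaviour [Fintype Q] :
    Nat.card (Option Q → Prop × Set Q) = behaviourCount (Fintype.card Q) := by
  classical
  simp [behaviourCount, Nat.card_eq_fintype_card]

theorem exists_shorter_of_behaviourCount_le [Fintype Q] {x : List S}
    (hx : behaviourCount (Fintype.card Q) ≤ x.length) :
    ∃ y : List S, y.length < x.length ∧ (TerminatesFrom M.LiveStep (M.initConfig y) →
      TerminatesFrom M.LiveStep (M.initConfig x)) := by
  let behaviour (i : Fin (x.length + 1)) := M.prefixBehaviour (inputTape x) i
  have hnotinj : ¬ Function.Injective behaviour := fun hinj => by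
    have hcard := Nat.card_le_card_of_injective behaviour hinj
    rw [card_prefixBehaviour, Nat.card_eq_fintype_card, Fintype.card_fin] at hcard
    omega
  obtain ⟨i, j, hij, hb⟩ : ∃ i j, i < j ∧ behaviour i = behaviour j := by
    contrapose! hnotinj
    exact .of_lt_imp_ne hnotinj
  refine ⟨x.take i ++ x.drop j, ?_, terminatesFrom_of_cut (Nat.lt_succ_iff.1 i.2) hb⟩
  simp only [List.length_append, List.length_take, List.length_drop]
  omega

theorem alwaysHalting_iff_short [Fintype Q] : M.AlwaysHalting ↔
    ∀ x, x.length < behaviourCount (Fintype.card Q) →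
      TerminatesFrom M.LiveStep (M.initConfig x) := by
  rw [alwaysHalting_iff_terminatesFrom]
  refine ⟨fun h x _ => h x, fun hshort x => ?_⟩
  induction hn : x.length using Nat.strong_induction_on generalizing x with
  | h n ih =>
    obtain hlt | hle := lt_or_ge x.length (behaviourCount (Fintype.card Q))
    · exact hshort x hlt
    · obtain ⟨y, hy, hyx⟩ := exists_shorter_of_behaviourCount_le (M := M) hle
      exact hyx (ih _ (hn ▸ hy) y rfl)

/-- The number of configurations of a one-head automaton with `n` states on an input that is
shorter than `behaviourCount n` is at most this. -/
def runBound (n : ℕ) : ℕ :=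
  n * (behaviourCount n + 1)

theorem alwaysHalting_iff_not_hasRun [Fintype Q] : M.AlwaysHalting ↔
    ∀ x, x.length < behaviourCount (Fintype.card Q) →
      ¬ HasRun M.LiveStep (runBound (Fintype.card Q)) (M.initConfig x) := by
  rw [alwaysHalting_iff_short]
  refine forall₂_congr fun x hx => terminatesFrom_iff_not_hasRun ?_
  simp only [Nat.card_eq_fintype_card, Fintype.card_prod, Fintype.card_pi, Fintype.card_fin,
    Finset.prod_const, Finset.card_univ, pow_one, runBound]
  exact Nat.mul_le_mul_left _ (by omega)

end MultiheadNFA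

section Lists

variable {α : Type*} {f : α → List α}

theorem iterate_flatMap_eq_nil_iff {t : ℕ} {l : List α} :
    (fun l => l.flatMap f)^[t] l = [] ↔ ∀ a ∈ l, ¬ HasRun (fun a b => b ∈ f a) t a := by
  induction t generalizing l with
  | zero => simp [HasRun, List.eq_nil_iff_forall_not_mem]
  | succ t ih =>
    simp only [Function.iterate_succ_apply, ih, List.mem_flatMap, HasRun]
    grind

theorem exists_eq_ofFn_comp_iff {γ : Type*} {k : ℕ} {g : γ → α} {l : List α} :
    (∃ y : Fin k → γ, l = List.ofFn fun i => g (y i)) ↔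
      l.length = k ∧ ∀ a ∈ l, a ∈ Set.range g := by
  constructor
  · rintro ⟨y, rfl⟩
    exact ⟨List.length_ofFn, List.forall_mem_ofFn_iff.2 fun i => ⟨y i, rfl⟩⟩
  · rintro ⟨rfl, hl⟩
    choose y hy using fun i : Fin l.length => hl l[i] (List.getElem_mem i.2)
    exact ⟨y, by simp only [hy, Fin.getElem_fin, List.ofFn_getElem]⟩

/-- All words of length less than `B` over the alphabet `0, …, m - 1`. -/
def wordsShorterThan (m B : ℕ) : List (List ℕ) :=
  (fun l => [] :: l.flatMap fun x => (List.range m).map (· :: x))^[B] []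

theorem mem_wordsShorterThan {m B : ℕ} {y : List ℕ} :
    y ∈ wordsShorterThan m B ↔ ∃ x : List (Fin m), x.length < B ∧ x.map Fin.val = y := by
  induction B generalizing y with
  | zero => simp [wordsShorterThan]
  | succ B ih =>
    rw [wordsShorterThan, Function.iterate_succ_apply', ← wordsShorterThan]
    simp only [List.mem_cons, List.mem_flatMap, List.mem_map, List.mem_range, ih]
    constructor
    · rintro (rfl | ⟨_, ⟨x, hx, rfl⟩, a, ha, rfl⟩)
      · exact ⟨[], Nat.succ_pos B, rfl⟩
      · exact ⟨⟨a, ha⟩ :: x, Nat.succ_lt_succ hx, rfl⟩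
    · rintro ⟨_ | ⟨a, x⟩, hx, rfl⟩
      · exact .inl rfl
      · exact .inr ⟨_, ⟨x, Nat.lt_of_succ_lt_succ hx, rfl⟩, a, a.2, rfl⟩

end Lists

theorem TapeSym.range_code (m : ℕ) : Set.range (code (m := m)) = Set.Iio (m + 2) := by
  ext a
  constructor
  · rintro ⟨_ | _ | a, rfl⟩ <;> simp [code]
  · intro ha
    match a, ha with
    | 0, _ => exact ⟨leftEnd, rfl⟩
    | 1, _ => exact ⟨rightEnd, rfl⟩
    | a + 2, ha => exact ⟨sym ⟨a, Nat.lt_of_add_lt_add_right ha⟩, rfl⟩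

theorem HeadMove.range_code : Set.range code = Set.Iio 3 := by
  ext a
  constructor
  · rintro ⟨_ | _ | _, rfl⟩ <;> simp [code]
  · intro ha
    match a, ha with
    | 0, _ => exact ⟨left, rfl⟩
    | 1, _ => exact ⟨stay, rfl⟩
    | 2, _ => exact ⟨right, rfl⟩

theorem val_moveHead_eq_min {N : ℕ} (p : Fin (N + 2)) (d : HeadMove) :
    (moveHead p d).val = min (p + d.code - 1) (N + 1) := by
  cases d <;> simp only [moveHead, HeadMove.code] <;> omega

theorem MultiheadNFA.liveTransition_headNFA_iff {k : ℕ} {Q S : Type} {M : MultiheadNFA k Q S}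
    {i : Fin k} {q r : Q} {z : TapeSym S} {d : HeadMove} :
    (M.headNFA i).LiveTransition q z r d ↔
      q ≠ M.qacc ∧ q ≠ M.qrej ∧ ∃ y v, (r, v) ∈ M.delta q y ∧ y i = z ∧ v i = d := by
  simp only [LiveTransition, headNFA, Set.mem_ofPred_eq, Prod.mk.injEq, funext_iff,
    forall_const]
  grind

theorem MultiheadNFA.headNFA_zero {Q S : Type} (M : MultiheadNFA 1 Q S) : M.headNFA 0 = M := by
  have hfun {α : Type} (v : Fin 1 → α) : (fun _ => v 0) = v :=
    funext fun i => by rw [Subsingleton.elim i 0]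
  obtain ⟨delta, q0, qacc, qrej⟩ := M
  simp only [headNFA, mk.injEq, and_true]
  funext q z
  ext e
  constructor
  · rintro ⟨y, hy, r, v, hmem, rfl⟩
    rwa [hfun, ← hfun z, ← hy, hfun]
  · intro hmem
    exact ⟨z, rfl, e.1, e.2, hmem, Prod.ext rfl (hfun e.2).symm⟩

namespace TransitionCode

/-- The state in which a written transition can be made. -/
abbrev source (e : TransitionCode) : ℕ := e.1

/-- The numbers of the symbols that a written transition reads. -/
abbrev read (e : TransitionCode) : List ℕ := e.2.1

/-- The state to which a written transition leads. -/
abbrev target (e : TransitionCode) : ℕ := e.2.2.1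

/-- The numbers of the head movements of a written transition. -/
abbrev moves (e : TransitionCode) : List ℕ := e.2.2.2

theorem getD_read_transitionCode {k n m : ℕ} (q : Fin n) (y : Fin k → TapeSym (Fin m))
    (r : Fin n) (d : Fin k → HeadMove) (i : Fin k) (a : ℕ) :
    (transitionCode q y r d).read.getD i a = (y i).code := by
  simp [transitionCode, read]

theorem getD_moves_transitionCode {k n m : ℕ} (q : Fin n) (y : Fin k → TapeSym (Fin m))
    (r : Fin n) (d : Fin k → HeadMove) (i : Fin k) (a : ℕ) :
    (transitionCode q y r d).moves.getD i a = (d i).code := by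
  simp [transitionCode, moves]

/-- `e` is the written form of a transition between `n` states, reading `m` input symbols with
`k` heads. -/
def WellFormed (k n m : ℕ) (e : TransitionCode) : Prop :=
  e.source < n ∧ (e.read.length = k ∧ ∀ a ∈ e.read, a < m + 2) ∧
    e.target < n ∧ e.moves.length = k ∧ ∀ a ∈ e.moves, a < 3

theorem wellFormed_iff {k n m : ℕ} {e : TransitionCode} :
    e.WellFormed k n m ↔ ∃ (q : Fin n) (y : Fin k → TapeSym (Fin m)) (r : Fin n)
      (d : Fin k → HeadMove), e = transitionCode q y r d := by
  obtain ⟨q, y, r, d⟩ := e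
  have hy := exists_eq_ofFn_comp_iff (k := k) (g := TapeSym.code (m := m)) (l := y)
  have hd := exists_eq_ofFn_comp_iff (k := k) (g := HeadMove.code) (l := d)
  rw [TapeSym.range_code] at hy
  rw [HeadMove.range_code] at hd
  simp only [Set.mem_Iio] at hy hd
  simp only [WellFormed, ← hy, ← hd, transitionCode, Prod.mk.injEq]
  constructor
  · rintro ⟨hq, ⟨y, hy⟩, hr, ⟨d, hd⟩⟩
    exact ⟨⟨q, hq⟩, y, ⟨r, hr⟩, d, rfl, hy, rfl, hd⟩
  · rintro ⟨q, y, r, d, rfl, hy, rfl, hd⟩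
    exact ⟨q.2, ⟨y, hy⟩, r.2, ⟨d, hd⟩⟩

end TransitionCode

namespace AutomatonCode

/-- The number of heads of a written automaton. -/
abbrev heads (c : AutomatonCode) : ℕ := c.1

/-- The number of states of a written automaton. -/
abbrev states (c : AutomatonCode) : ℕ := c.2.1

/-- The number of input symbols of a written automaton. -/
abbrev symbols (c : AutomatonCode) : ℕ := c.2.2.1

/-- The initial state of a written automaton. -/
abbrev init (c : AutomatonCode) : ℕ := c.2.2.2.1

/-- The accept state of a written automaton. -/
abbrev acc (c : AutomatonCode) : ℕ := c.2.2.2.2.1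

/-- The reject state of a written automaton. -/
abbrev rej (c : AutomatonCode) : ℕ := c.2.2.2.2.2.1

/-- The list of transitions of a written automaton. -/
abbrev transitions (c : AutomatonCode) : List TransitionCode := c.2.2.2.2.2.2

/-- `c` encodes some automaton. -/
def WellFormed (c : AutomatonCode) : Prop :=
  c.init < c.states ∧ c.acc < c.states ∧ c.rej < c.states ∧
    ∀ e ∈ c.transitions, e.WellFormed c.heads c.states c.symbols

theorem wellFormed_of_encodes {c : AutomatonCode} {k n m : ℕ}
    {M : MultiheadNFA k (Fin n) (Fin m)} (h : Encodes c M) : c.WellFormed := by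
  obtain ⟨L, rfl, hL⟩ := h
  refine ⟨M.q0.2, M.qacc.2, M.qrej.2, fun e he => TransitionCode.wellFormed_iff.2 ?_⟩
  obtain ⟨q, y, r, d, -, he⟩ := (hL e).1 he
  exact ⟨q, y, r, d, he⟩

theorem WellFormed.exists_encodes {c : AutomatonCode} (h : c.WellFormed) :
    ∃ M : MultiheadNFA c.heads (Fin c.states) (Fin c.symbols), Encodes c M := by
  obtain ⟨hinit, hacc, hrej, htrans⟩ := h
  refine ⟨⟨fun q y => {e | transitionCode q y e.1 e.2 ∈ c.transitions},
    ⟨_, hinit⟩, ⟨_, hacc⟩, ⟨_, hrej⟩⟩, c.transitions, rfl, fun e => ⟨fun he => ?_, ?_⟩⟩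
  · obtain ⟨q, y, r, d, rfl⟩ := TransitionCode.wellFormed_iff.1 (htrans e he)
    exact ⟨q, y, r, d, he, rfl⟩
  · rintro ⟨q, y, r, d, he, rfl⟩
    exact he

/-- The number of the symbol in cell `p` of the tape of the input `x`, a list of numbers of input
symbols. -/
def tapeCode (x : List ℕ) (p : ℕ) : ℕ :=
  (0 :: x.map (· + 2)).getD p 1

theorem tapeCode_map_val {m : ℕ} (x : List (Fin m)) (p : ℕ) :
    tapeCode (x.map Fin.val) p = (inputTape x p).code := by
  rw [inputTape, ← List.getD_map (f := TapeSym.code), tapeCode, List.map_map, List.map_cons,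
    List.map_map]
  rfl

/-- The configurations, as pairs of a state and a head position, that the one-head automaton of
head `i` can reach in one step from `s` on the input `x`. -/
def successors (c : AutomatonCode) (i : ℕ) (x : List ℕ) (s : ℕ × ℕ) : List (ℕ × ℕ) :=
  c.transitions.filterMap fun e =>
    if s.1 ≠ c.acc ∧ s.1 ≠ c.rej ∧ e.source = s.1 ∧ e.read.getD i 0 = tapeCode x s.2 then
      some (e.target, min (s.2 + e.moves.getD i 0 - 1) (x.length + 1))
    else none

variable {c : AutomatonCode} {k n m : ℕ} {M : MultiheadNFA k (Fin n) (Fin m)}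

theorem isBisimulationMap_successors (h : Encodes c M) (i : Fin k) (x : List (Fin m)) :
    IsBisimulationMap ((M.headNFA i).LiveStep (x := x))
      (fun s b => b ∈ c.successors i (x.map Fin.val) s) fun a => (a.1.val, (a.2 0).val) := by
  obtain ⟨L, rfl, hL⟩ := h
  rintro ⟨q, p⟩ b
  simp only [successors, List.mem_filterMap, Option.ite_none_right_eq_some, Option.some.injEq,
    tapeCode_map_val, List.length_map, MultiheadNFA.liveStep_iff,
    MultiheadNFA.liveTransition_headNFA_iff, readTape_eq_inputTape]
  constructor
  · rintro ⟨e, he, ⟨hacc, hrej, hsource, hread⟩, rfl⟩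
    obtain ⟨q, y, r, v, hmem, rfl⟩ := (hL e).1 he
    obtain rfl := Fin.ext hsource
    rw [TransitionCode.getD_read_transitionCode] at hread
    refine ⟨(r, fun _ => moveHead (p 0) (v i)), ⟨v i, ⟨?_, ?_, y, v, hmem, ?_, rfl⟩, rfl⟩, ?_⟩
    · exact fun h => hacc (congrArg Fin.val h)
    · exact fun h => hrej (congrArg Fin.val h)
    · exact TapeSym.code_injective hread
    · rw [val_moveHead_eq_min, TransitionCode.getD_moves_transitionCode]
      rfl
  · rintro ⟨c', ⟨d, ⟨hacc, hrej, y, v, hmem, hy, rfl⟩, hpos⟩, rfl⟩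
    refine ⟨_, (hL _).2 ⟨q, y, c'.1, v, hmem, rfl⟩, ⟨?_, ?_, rfl, ?_⟩, ?_⟩
    · exact fun h => hacc (Fin.ext h)
    · exact fun h => hrej (Fin.ext h)
    · rw [TransitionCode.getD_read_transitionCode, hy]
    · rw [hpos, val_moveHead_eq_min, TransitionCode.getD_moves_transitionCode]
      rfl

/-- No run of the one-head automaton of head `i` on an input shorter than `behaviourCount` is so
long that it would have to repeat a configuration. -/
def HeadTerminates (c : AutomatonCode) (i : ℕ) : Prop :=
  ∀ x ∈ wordsShorterThan c.symbols (MultiheadNFA.behaviourCount c.states),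
    (fun l => l.flatMap (c.successors i x))^[MultiheadNFA.runBound c.states] [(c.init, 0)] = []

theorem safeHead_iff_headTerminates (h : Encodes c M) (i : Fin k) :
    M.SafeHead i ↔ c.HeadTerminates i := by
  rw [MultiheadNFA.SafeHead, MultiheadNFA.alwaysHalting_iff_not_hasRun]
  have hbisim := isBisimulationMap_successors h i
  obtain ⟨L, rfl, -⟩ := h
  simp only [HeadTerminates, mem_wordsShorterThan, forall_exists_index, and_imp,
    forall_apply_eq_imp_iff₂, iterate_flatMap_eq_nil_iff, List.mem_singleton, forall_eq,
    Fintype.card_fin, ← (hbisim _).hasRun_iff]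
  rfl

theorem exists_encodes_head_iff {φ : ∀ {k n m : ℕ}, MultiheadNFA k (Fin n) (Fin m) → Fin k → Prop}
    {D : ℕ → Prop} {j : ℕ}
    (hφ : ∀ {k n m : ℕ} {M : MultiheadNFA k (Fin n) (Fin m)}, Encodes c M → ∀ i, φ M i ↔ D i) :
    (∃ (k n m : ℕ) (M : MultiheadNFA k (Fin n) (Fin m)) (i : Fin k),
      Encodes c M ∧ j = i.val ∧ φ M i) ↔ c.WellFormed ∧ j < c.heads ∧ D j := by
  constructor
  · rintro ⟨k, n, m, M, i, h, rfl, hi⟩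
    refine ⟨wellFormed_of_encodes h, ?_, (hφ h i).1 hi⟩
    obtain ⟨L, rfl, -⟩ := h
    exact i.2
  · rintro ⟨hc, hj, hD⟩
    obtain ⟨M, h⟩ := hc.exists_encodes
    exact ⟨_, _, _, M, ⟨j, hj⟩, h, rfl, (hφ h _).2 hD⟩

theorem mem_safeHeads_iff {j : ℕ} :
    (c, j) ∈ SafeHeads ↔ c.WellFormed ∧ j < c.heads ∧ c.HeadTerminates j :=
  exists_encodes_head_iff (φ := MultiheadNFA.SafeHead) safeHead_iff_headTerminates

theorem mem_riskyHeads_iff {j : ℕ} :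
    (c, j) ∈ RiskyHeads ↔ c.WellFormed ∧ j < c.heads ∧ ¬ c.HeadTerminates j :=
  exists_encodes_head_iff (φ := MultiheadNFA.RiskyHead) (D := fun j => ¬ c.HeadTerminates j)
    fun h i => not_congr (safeHead_iff_headTerminates h i)

theorem mem_decider2NFA_iff : c ∈ Decider2NFA ↔ c.heads = 1 ∧ (c, 0) ∈ SafeHeads := by
  constructor
  · rintro ⟨n, m, M, h, hM⟩
    have hk : c.heads = 1 := by
      obtain ⟨L, rfl, -⟩ := h
      rfl
    exact ⟨hk, 1, n, m, M, 0, h, rfl, by rwa [MultiheadNFA.SafeHead, M.headNFA_zero]⟩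
  · rintro ⟨hk, k, n, m, M, i, h, -, hM⟩
    obtain rfl : k = 1 := by
      obtain ⟨L, rfl, -⟩ := h
      exact hk
    rw [Subsingleton.elim i 0, MultiheadNFA.SafeHead, M.headNFA_zero] at hM
    exact ⟨n, m, M, h, hM⟩

end AutomatonCode

section Primrec

open Primrec

theorem primrec_wordsShorterThan : Primrec₂ wordsShorterThan := by
  have hcons : Primrec₂ fun (a : ((ℕ × ℕ) × List (List ℕ)) × List ℕ) (b : ℕ) => b :: a.2 :=
    (list_cons.comp snd (snd.comp fst)).to₂
  have hextend : Primrec₂ fun (a : (ℕ × ℕ) × List (List ℕ)) (x : List ℕ) =>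
      (List.range a.1.1).map (· :: x) :=
    (list_map (list_range.comp (fst.comp (fst.comp fst))) hcons).to₂
  exact nat_iterate snd (const []) (list_cons.comp (const []) (list_flatMap snd hextend)).to₂

theorem MultiheadNFA.primrec_behaviourCount : Primrec behaviourCount := by
  have hpow : Primrec₂ fun a b : ℕ => a ^ b := Primrec₂.unpaired'.1 Nat.Primrec.pow
  exact hpow.comp (nat_mul.comp (const 2) (hpow.comp (const 2) .id)) succ

theorem MultiheadNFA.primrec_runBound : Primrec runBound :=
  nat_mul.comp .id (succ.comp primrec_behaviourCount)

namespace TransitionCode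

theorem primrec_source : Primrec source :=
  fst

theorem primrec_read : Primrec read :=
  fst.comp snd

theorem primrec_target : Primrec target :=
  fst.comp (snd.comp snd)

theorem primrec_moves : Primrec moves :=
  snd.comp (snd.comp snd)

end TransitionCode

namespace AutomatonCode

theorem primrec_heads : Primrec heads :=
  fst

theorem primrec_states : Primrec states :=
  fst.comp snd

theorem primrec_symbols : Primrec symbols :=
  fst.comp (snd.comp snd)

theorem primrec_init : Primrec init :=
  fst.comp (snd.comp (snd.comp snd))

theorem primrec_acc : Primrec acc :=
  fst.comp (snd.comp (snd.comp (snd.comp snd)))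

theorem primrec_rej : Primrec rej :=
  fst.comp (snd.comp (snd.comp (snd.comp (snd.comp snd))))

theorem primrec_transitions : Primrec transitions :=
  snd.comp (snd.comp (snd.comp (snd.comp (snd.comp snd))))

theorem primrecRel_transitionWellFormed :
    PrimrecRel fun (e : TransitionCode) (c : AutomatonCode) =>
      e.WellFormed c.heads c.states c.symbols := by
  have hlt : PrimrecRel fun (l : List ℕ) (b : ℕ) => ∀ a ∈ l, a < b := nat_lt.forall_mem_list
  have hstates : Primrec fun a : TransitionCode × AutomatonCode => a.2.states :=
    primrec_states.comp snd
  have hheads : Primrec fun a : TransitionCode × AutomatonCode => a.2.heads :=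
    primrec_heads.comp snd
  have hread : Primrec fun a : TransitionCode × AutomatonCode => a.1.read :=
    TransitionCode.primrec_read.comp fst
  have hmoves : Primrec fun a : TransitionCode × AutomatonCode => a.1.moves :=
    TransitionCode.primrec_moves.comp fst
  have hcodes : Primrec fun a : TransitionCode × AutomatonCode => a.2.symbols + 2 :=
    nat_add.comp (primrec_symbols.comp snd) (const 2)
  exact (nat_lt.comp (TransitionCode.primrec_source.comp fst) hstates).and <|
    .and (.and (Primrec.eq.comp (list_length.comp hread) hheads) (hlt.comp hread hcodes)) <|
    .and (nat_lt.comp (TransitionCode.primrec_target.comp fst) hstates) <|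
    .and (Primrec.eq.comp (list_length.comp hmoves) hheads) (hlt.comp hmoves (const 3))

theorem primrecPred_wellFormed : PrimrecPred WellFormed :=
  (nat_lt.comp primrec_init primrec_states).and <|
    (nat_lt.comp primrec_acc primrec_states).and <|
    (nat_lt.comp primrec_rej primrec_states).and <|
    primrecRel_transitionWellFormed.forall_mem_list.comp primrec_transitions .id

theorem primrec_tapeCode : Primrec₂ tapeCode := by
  have hshift : Primrec₂ fun (_ : List ℕ × ℕ) (a : ℕ) => a + 2 := (nat_add.comp snd (const 2)).to₂
  exact (list_getD 1).comp (list_cons.comp (const 0) (list_map fst hshift)) snd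

theorem primrec_successors :
    Primrec₂ fun (a : (AutomatonCode × ℕ) × List ℕ) (s : ℕ × ℕ) =>
      a.1.1.successors a.1.2 a.2 s := by
  let Args := (((AutomatonCode × ℕ) × List ℕ) × ℕ × ℕ) × TransitionCode
  have hcode : Primrec fun a : Args => a.1.1.1.1 := fst.comp (fst.comp (fst.comp fst))
  have hhead : Primrec fun a : Args => a.1.1.1.2 := snd.comp (fst.comp (fst.comp fst))
  have hinput : Primrec fun a : Args => a.1.1.2 := snd.comp (fst.comp fst)
  have hstate : Primrec fun a : Args => a.1.2.1 := fst.comp (snd.comp fst)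
  have hpos : Primrec fun a : Args => a.1.2.2 := snd.comp (snd.comp fst)
  have hread : Primrec fun a : Args => a.2.read.getD a.1.1.1.2 0 :=
    (list_getD 0).comp (TransitionCode.primrec_read.comp snd) hhead
  have hmove : Primrec fun a : Args => a.2.moves.getD a.1.1.1.2 0 :=
    (list_getD 0).comp (TransitionCode.primrec_moves.comp snd) hhead
  refine listFilterMap (primrec_transitions.comp (fst.comp (fst.comp fst))) <|
    Primrec.ite ?_ (option_some.comp (.pair (TransitionCode.primrec_target.comp snd) ?_))
      (const none)
  · exact (Primrec.eq.comp hstate (primrec_acc.comp hcode)).not.and <|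
      (Primrec.eq.comp hstate (primrec_rej.comp hcode)).not.and <|
      (Primrec.eq.comp (TransitionCode.primrec_source.comp snd) hstate).and <|
      Primrec.eq.comp hread (primrec_tapeCode.comp hinput hpos)
  · exact nat_min.comp (nat_sub.comp (nat_add.comp hpos hmove) (const 1))
      (succ.comp (list_length.comp hinput))

theorem primrecRel_headTerminates : PrimrecRel HeadTerminates := by
  have hstep : Primrec₂ fun (a : List ℕ × AutomatonCode × ℕ) (l : List (ℕ × ℕ)) =>
      l.flatMap (a.2.1.successors a.2.2 a.1) :=
    list_flatMap snd <| primrec_successors.comp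
      (.pair (snd.comp (fst.comp fst)) (fst.comp (fst.comp fst))) snd
  have hstates : Primrec fun a : List ℕ × AutomatonCode × ℕ => a.2.1.states :=
    primrec_states.comp (fst.comp snd)
  have hstart : Primrec fun a : List ℕ × AutomatonCode × ℕ => [(a.2.1.init, 0)] :=
    list_cons.comp (.pair (primrec_init.comp (fst.comp snd)) (const 0)) (const [])
  have hhalts : PrimrecRel fun (x : List ℕ) (a : AutomatonCode × ℕ) =>
      (fun l => l.flatMap (a.1.successors a.2 x))^[MultiheadNFA.runBound a.1.states]
        [(a.1.init, 0)] = [] :=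
    Primrec.eq.comp (nat_iterate (MultiheadNFA.primrec_runBound.comp hstates) hstart hstep)
      (const [])
  have hwords : Primrec fun a : AutomatonCode × ℕ =>
      wordsShorterThan a.1.symbols (MultiheadNFA.behaviourCount a.1.states) :=
    primrec_wordsShorterThan.comp (primrec_symbols.comp fst)
      (MultiheadNFA.primrec_behaviourCount.comp (primrec_states.comp fst))
  exact hhalts.forall_mem_list.comp hwords .id

end AutomatonCode

end Primrec

theorem mainTheorem6_general :
    PrimrecPred (fun c : AutomatonCode => c ∈ Decider2NFA) ∧
    PrimrecPred (fun p : AutomatonCode × ℕ => p ∈ SafeHeads) ∧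
    PrimrecPred (fun p : AutomatonCode × ℕ => p ∈ RiskyHeads) := by
  have hwell : PrimrecPred fun p : AutomatonCode × ℕ => p.1.WellFormed :=
    AutomatonCode.primrecPred_wellFormed.comp .fst
  have hindex : PrimrecPred fun p : AutomatonCode × ℕ => p.2 < p.1.heads :=
    Primrec.nat_lt.comp .snd (AutomatonCode.primrec_heads.comp .fst)
  have hterm : PrimrecPred fun p : AutomatonCode × ℕ => p.1.HeadTerminates p.2 :=
    AutomatonCode.primrecRel_headTerminates
  have hsafe : PrimrecPred fun p : AutomatonCode × ℕ => p ∈ SafeHeads :=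
    (hwell.and (hindex.and hterm)).of_eq fun _ => AutomatonCode.mem_safeHeads_iff.symm
  have hrisky : PrimrecPred fun p : AutomatonCode × ℕ => p ∈ RiskyHeads :=
    (hwell.and (hindex.and hterm.not)).of_eq fun _ => AutomatonCode.mem_riskyHeads_iff.symm
  have honeHead : PrimrecPred fun c : AutomatonCode => c.heads = 1 :=
    Primrec.eq.comp AutomatonCode.primrec_heads (.const 1)
  have hzero : PrimrecPred fun c : AutomatonCode => (c, 0) ∈ SafeHeads :=
    hsafe.comp (.pair .id (.const 0))
  exact ⟨(honeHead.and hzero).of_eq fun _ => AutomatonCode.mem_decider2NFA_iff.symm,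
    hsafe, hrisky⟩

theorem mainTheorem6 :
    ComputablePred (fun c : AutomatonCode => c ∈ Decider2NFA) ∧
    ComputablePred (fun p : AutomatonCode × ℕ => p ∈ SafeHeads) ∧
    ComputablePred (fun p : AutomatonCode × ℕ => p ∈ RiskyHeads) := by
  obtain ⟨hdecider, hsafe, hrisky⟩ := mainTheorem6_general
  exact ⟨hdecider.computablePred, hsafe.computablePred, hrisky.computablePred⟩
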